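/- **Theorem (a Hardy-type inequality).** Let $d\ge 1$ be an integer, $p\in[1,\infty)$, $s\in(0,1)$ with $ps\neq 1$, and let $\mathbb{R}^d_+=\{x\in\mathbb{R}^d : x_d>0\}$. For a measurable vector field $u:\mathbb{R}^d_+\to\mathbb{R}^d$ put $$|u|^p_{\mathcal S_{p,s}(\mathbb{R}^d_+)}=\int_{\mathbb{R}^d_+}\int_{\mathbb{R}^d_+}\frac{\left|(u(y)-u(x))\cdot\frac{y-x}{|y-x|}\right|^p}{|y-x|^{d+ps}}\,dy\,dx\in[0,\infty].$$ Let $C^1_c(\mathbb{R}^d_+;\mathbb{R}^d)$ be the space of $C^1$ vector fields with compact support contained in the open set $\mathbb{R}^d_+$, and let $\mathcal S_{p,s}(\mathbb{R}^d_+)$ be the closure of $C^1_c(\mathbb{R}^d_+;\mathbb{R}^d)$ in $\{u\in L^p(\mathbb{R}^d_+;\mathbb{R}^d): |u|_{\mathcal S_{p,s}(\mathbb{R}^d_+)}<\infty\}$ with respect to the norm $\left(\|u\|^p_{L^p(\mathbb{R}^d_+)}+|u|^p_{\mathcal S_{p,s}(\mathbb{R}^d_+)}\right)^{1/p}$. Then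 there exists a constant $\kappa=\kappa(p,d,s)>0$, depending only on $p$, $d$ and $s$, such that $$\int_{\mathbb{R}^d_+}\frac{|u(x)|^p}{x_d^{ps}}\,dx\le\kappa\,|u|^p_{\mathcal S_{p,s}(\mathbb{R}^d_+)}$$ for all $u\in C^1_c(\mathbb{R}^d_+;\mathbb{R}^d)$, and, with the same constant, for all $u\in\mathcal S_{p,s}(\mathbb{R}^d_+)$. -/

import Mathlib

open MeasureTheory TopologicalSpace
open scoped ENNReal Distributions

noncomputable section

namespace FractionalHardy

/-- `ℝ^d` with its Euclidean norm and inner product. -/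
abbrev RSpace (d : ℕ) : Type := EuclideanSpace ℝ (Fin d)

/-- The index of the last coordinate `x_d` of a point of `ℝ^d`, `d ≥ 1`. -/
def lastIdx (d : ℕ) (hd : 1 ≤ d) : Fin d := ⟨d - 1, by omega⟩

/-- The open half space `ℝ^d_+ = {x ∈ ℝ^d : x_d > 0}`. -/
def halfSpace (d : ℕ) (hd : 1 ≤ d) : Opens (RSpace d) where
  carrier := {x | 0 < x (lastIdx d hd)}
  is_open' := isOpen_lt continuous_const (by fun_prop)

/-- The projected difference `(u(y) - u(x)) · (y - x) / |y - x|`. -/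
def projDiff {d : ℕ} (u : RSpace d → RSpace d) (x y : RSpace d) : ℝ :=
  inner ℝ (u y - u x) (‖y - x‖⁻¹ • (y - x))

/-- The `p`-th power `|u|^p_{S_{p,s}(Ω)}` of the seminorm, with values in `[0, ∞]`:
`∫_Ω ∫_Ω |(u(y) - u(x)) · (y - x) / |y - x||^p / |y - x|^(d + p s) dy dx`. -/
def seminormPow {d : ℕ} (p s : ℝ) (Ω : Opens (RSpace d)) (u : RSpace d → RSpace d) : ℝ≥0∞ :=
  ∫⁻ x in (Ω : Set (RSpace d)), ∫⁻ y in (Ω : Set (RSpace d)),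
    ENNReal.ofReal (|projDiff u x y| ^ p / ‖y - x‖ ^ ((d : ℝ) + p * s))

/-- The norm `(‖u‖^p_{L^p(Ω)} + |u|^p_{S_{p,s}(Ω)})^(1/p)`, with values in `[0, ∞]`. -/
def sNorm {d : ℕ} (p s : ℝ) (Ω : Opens (RSpace d)) (u : RSpace d → RSpace d) : ℝ≥0∞ :=
  (eLpNorm u (ENNReal.ofReal p) (volume.restrict (Ω : Set (RSpace d))) ^ p
    + seminormPow p s Ω u) ^ (1 / p)

/-- Membership in `S_{p,s}(Ω)`, the closure of `C¹_c(Ω; ℝ^d)` for the norm `sNorm` in the space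
of all `u ∈ L^p(Ω; ℝ^d)` with finite seminorm. Here `𝓓^{1}(Ω, ℝ^d)` is the space of `C¹` maps
with compact support contained in `Ω`. -/
def MemS {d : ℕ} (p s : ℝ) (Ω : Opens (RSpace d)) (u : RSpace d → RSpace d) : Prop :=
  MemLp u (ENNReal.ofReal p) (volume.restrict (Ω : Set (RSpace d))) ∧
  seminormPow p s Ω u < ∞ ∧
  ∀ ε : ℝ≥0∞, 0 < ε → ∃ φ : 𝓓^{1}(Ω, RSpace d), sNorm p s Ω (fun x => u x - φ x) < ε

/-- The left-hand side `∫_{ℝ^d_+} |u(x)|^p / x_d^(p s) dx`, with values in `[0, ∞]`. -/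
def hardyIntegral (d : ℕ) (hd : 1 ≤ d) (p s : ℝ) (u : RSpace d → RSpace d) : ℝ≥0∞ :=
  ∫⁻ x in (halfSpace d hd : Set (RSpace d)),
    ENNReal.ofReal (‖u x‖ ^ p / (x (lastIdx d hd)) ^ (p * s))

end FractionalHardy

end

/-! For a direction `v`, the scalar function `g = u · v` is compared with its composition with the
shear `x ↦ x + x_d v`. This shear multiplies `x_d` by `1 + v_d`, which is also its Jacobian, so the
composition multiplies the integral `X` of `|g|^p x_d^(-ps)` by `(1 + v_d)^(ps-1)`. Since `ps ≠ 1`,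
the sign of `v_d` can be chosen to make this factor less than one. Minkowski's inequality then
bounds `X` by the increments of `g` along the shear, provided `X` is finite
(`setLIntegral_le_of_shear`).

The displacement `x_d v` is parallel to `v`, so these increments involve only the projected
difference of `u`. Averaging over a ball of directions recovers `|u|^p` on the left
(`le_setLIntegral_ball_inner`). On the right, the substitution `y = x + x_d v` at fixed `x` produces
the kernel of the seminorm (`setLIntegral_increment_le`).

Test functions have a finite Hardy integral, and Fatou's lemma carries the inequality to the closure
(`hardyIntegral_le_of_approx`). -/

namespace FractionalHardy

/-! ### Changes of variables and averaging over directions. -/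

/-- The map `x ↦ x + x_d v` preserves the half space and scales volume by `1 + v_d`. -/
lemma setLIntegral_shear {d : ℕ} (hd : 1 ≤ d) (v : RSpace d) (hv : 0 < 1 + v (lastIdx d hd))
    {F : RSpace d → ℝ≥0∞} (hF : Measurable F) :
    ∫⁻ x in (halfSpace d hd : Set (RSpace d)), F (x + x (lastIdx d hd) • v) =
      ENNReal.ofReal (1 + v (lastIdx d hd))⁻¹ *
        ∫⁻ x in (halfSpace d hd : Set (RSpace d)), F x := by
  set L := lastIdx d hd
  have hH : MeasurableSet (halfSpace d hd : Set (RSpace d)) := (halfSpace d hd).isOpen.measurableSet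
  let f : Module.Dual ℝ (RSpace d) := (EuclideanSpace.proj (𝕜 := ℝ) L).toLinearMap
  let T : RSpace d →ₗ[ℝ] RSpace d := LinearMap.transvection f v
  have hT : ∀ x, T x = x + x L • v := fun x => rfl
  have hdet : LinearMap.det T = 1 + v L := LinearMap.transvection.det f v
  have hTm : Measurable T := (LinearMap.continuous_of_finiteDimensional T).measurable
  have hmem : ∀ x, T x ∈ (halfSpace d hd : Set (RSpace d)) ↔
      x ∈ (halfSpace d hd : Set (RSpace d)) := by
    intro x
    have h1 : (T x) L = x L * (1 + v L) := by
      rw [hT]; simp; ring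
    change 0 < (T x) L ↔ 0 < x L
    rw [h1]
    exact mul_pos_iff_of_pos_right hv
  have key : ∀ x, (halfSpace d hd : Set (RSpace d)).indicator (fun x => F (x + x L • v)) x =
      (halfSpace d hd : Set (RSpace d)).indicator F (T x) := by
    intro x
    by_cases hx : x ∈ (halfSpace d hd : Set (RSpace d))
    · rw [Set.indicator_of_mem hx, Set.indicator_of_mem ((hmem x).2 hx), hT]
    · rw [Set.indicator_of_notMem hx, Set.indicator_of_notMem (fun h => hx ((hmem x).1 h))]
  rw [← lintegral_indicator hH, ← lintegral_indicator hH]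
  simp_rw [key]
  rw [← lintegral_map (hF.indicator hH) hTm,
    Measure.map_linearMap_addHaar_eq_smul_addHaar volume (by rw [hdet]; exact hv.ne'), hdet,
    lintegral_smul_measure, abs_of_pos (inv_pos.2 hv), smul_eq_mul]

/-- Applied with `t = x_d` to pass from directions `v` to points `y` of the half space. -/
lemma lintegral_comp_add_smul {d : ℕ} (x : RSpace d) {t : ℝ} (ht : 0 < t)
    {F : RSpace d → ℝ≥0∞} (hF : Measurable F) :
    ENNReal.ofReal (t ^ d) * ∫⁻ v, F (x + t • v) = ∫⁻ y, F y := by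
  have h1 : ∫⁻ v, F (x + t • v) = ENNReal.ofReal (t ^ d)⁻¹ * ∫⁻ y, F y := by
    rw [← lintegral_map (f := fun y => F (x + y)) (g := fun v : RSpace d => t • v)
      (hF.comp (measurable_const_add x)) (measurable_const_smul t),
      Measure.map_addHaar_smul volume ht.ne', lintegral_smul_measure,
      lintegral_add_left_eq_self]
    simp [abs_of_pos ht]
  rw [h1, ← mul_assoc, ← ENNReal.ofReal_mul (by positivity), mul_inv_cancel₀ (by positivity)]
  simp

/-- The average of `|⟪w, v⟫| ^ p` over directions `v` in a ball is bounded below by a multiple of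
`‖w‖ ^ p` that does not depend on the centre. -/
lemma le_setLIntegral_ball_inner {d : ℕ} {p : ℝ} (hp : 0 < p) (w v₀ : RSpace d) {r : ℝ}
    (hr : 0 < r) :
    ENNReal.ofReal (r / 4) ^ p * volume (Metric.ball (0 : RSpace d) (r / 4)) *
        ENNReal.ofReal ‖w‖ ^ p ≤
      ∫⁻ v in Metric.ball v₀ r, ENNReal.ofReal |inner ℝ w v| ^ p := by
  rcases eq_or_ne w 0 with rfl | hw
  · simp [ENNReal.zero_rpow_of_pos hp]
  have hw' : 0 < ‖w‖ := norm_pos_iff.2 hw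
  -- The sign `σ` moves the centre by `r / 2` along `± w`, so that the gain in the inner product
  -- with `w` adds to that of `v₀` instead of cancelling it. On the ball of radius `r / 4` about the
  -- new centre, at least `r / 2 - r / 4` times `‖w‖` survives.
  obtain ⟨σ, hσ, hσ0⟩ : ∃ σ : ℝ, |σ| = 1 ∧ 0 ≤ σ * inner ℝ w v₀ := by
    rcases le_total 0 (inner ℝ w v₀) with h | h
    · exact ⟨1, by simp, by simpa using h⟩
    · exact ⟨-1, by simp, by simpa using h⟩
  have hσ2 : σ * σ = 1 := by rw [← abs_mul_abs_self, hσ, one_mul]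
  set c : RSpace d := v₀ + (σ * (r / 2) * ‖w‖⁻¹) • w with hc
  have hcv : ‖c - v₀‖ = r / 2 := by
    rw [hc, add_sub_cancel_left, norm_smul, norm_mul, norm_mul, norm_inv, norm_norm,
      Real.norm_eq_abs, hσ, Real.norm_of_nonneg (by positivity)]
    field_simp
  have hsub : Metric.ball c (r / 4) ⊆ Metric.ball v₀ r := by
    apply Metric.ball_subset_ball'
    rw [dist_eq_norm, hcv]; linarith
  have hlow : ∀ v ∈ Metric.ball c (r / 4), r / 4 * ‖w‖ ≤ |inner ℝ w v| := by
    intro v hv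
    have h1 : inner ℝ w v = inner ℝ w v₀ + σ * (r / 2) * ‖w‖ + inner ℝ w (v - c) := by
      rw [inner_sub_right, hc, inner_add_right, inner_smul_right, real_inner_self_eq_norm_sq]
      field_simp
      ring
    have h2 : |inner ℝ w (v - c)| ≤ ‖w‖ * (r / 4) := by
      refine (abs_real_inner_le_norm _ _).trans ?_
      gcongr
      rw [← dist_eq_norm]; exact (Metric.mem_ball.1 hv).le
    have h3 : |σ * inner ℝ w (v - c)| ≤ ‖w‖ * (r / 4) := by rwa [abs_mul, hσ, one_mul]
    have h4 : |inner ℝ w v| = |σ * inner ℝ w v| := by rw [abs_mul, hσ, one_mul]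
    have h5 : σ * inner ℝ w v = σ * inner ℝ w v₀ + r / 2 * ‖w‖ + σ * inner ℝ w (v - c) := by
      rw [h1]; linear_combination (r / 2 * ‖w‖) * hσ2
    rw [h4, h5]
    have := (abs_le.1 h3).1
    refine le_trans ?_ (le_abs_self _)
    linarith
  calc ENNReal.ofReal (r / 4) ^ p * volume (Metric.ball (0 : RSpace d) (r / 4)) *
        ENNReal.ofReal ‖w‖ ^ p
      = ∫⁻ _ in Metric.ball c (r / 4), ENNReal.ofReal (r / 4 * ‖w‖) ^ p := by
        rw [setLIntegral_const, Measure.addHaar_ball_center volume c,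
          ENNReal.ofReal_mul (by positivity), ENNReal.mul_rpow_of_nonneg _ _ hp.le]
        ring
    _ ≤ ∫⁻ v in Metric.ball c (r / 4), ENNReal.ofReal |inner ℝ w v| ^ p := by
        refine setLIntegral_mono' measurableSet_ball fun v hv => ?_
        gcongr
        exact hlow v hv
    _ ≤ _ := lintegral_mono_set hsub

/-! ### Contraction along shears and comparison with the kernel. -/

/-- A dilation argument: a function whose weighted norm contracts under
the shear `x ↦ x + x_d v` is controlled by its increments along the shear. -/
lemma setLIntegral_le_of_shear {d : ℕ} (hd : 1 ≤ d) {p s θ : ℝ} (hp : 1 ≤ p) (v : RSpace d)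
    (hv : 0 < 1 + v (lastIdx d hd)) (hθ : (1 + v (lastIdx d hd)) ^ ((p * s - 1) / p) ≤ θ)
    (hθ1 : θ < 1) {g : RSpace d → ℝ} (hg : Measurable g)
    (hfin : ∫⁻ x in (halfSpace d hd : Set (RSpace d)),
      ENNReal.ofReal (|g x| * x (lastIdx d hd) ^ (-s)) ^ p ≠ ∞) :
    ∫⁻ x in (halfSpace d hd : Set (RSpace d)),
        ENNReal.ofReal (|g x| * x (lastIdx d hd) ^ (-s)) ^ p ≤
      ENNReal.ofReal (1 - θ)⁻¹ ^ p * ∫⁻ x in (halfSpace d hd : Set (RSpace d)),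
        ENNReal.ofReal (|g (x + x (lastIdx d hd) • v) - g x| * x (lastIdx d hd) ^ (-s)) ^ p := by
  set L := lastIdx d hd
  set lam := 1 + v L
  have hp0 : 0 < p := by linarith
  have hH : MeasurableSet (halfSpace d hd : Set (RSpace d)) := (halfSpace d hd).isOpen.measurableSet
  have hL : Measurable fun x : RSpace d => x L := by fun_prop
  have hT : Measurable fun x : RSpace d => x + x L • v := by fun_prop
  have hw : Measurable fun x : RSpace d => x L ^ (-s) := hL.pow_const _
  set X := ∫⁻ x in (halfSpace d hd : Set (RSpace d)), ENNReal.ofReal (|g x| * x L ^ (-s)) ^ p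
    with hX
  set D := ∫⁻ x in (halfSpace d hd : Set (RSpace d)),
    ENNReal.ofReal (|g (x + x L • v) - g x| * x L ^ (-s)) ^ p with hD
  have hθ0 : 0 ≤ θ := (Real.rpow_nonneg hv.le _).trans hθ
  have hshift : ∫⁻ x in (halfSpace d hd : Set (RSpace d)),
      ENNReal.ofReal (|g (x + x L • v)| * x L ^ (-s)) ^ p =
        ENNReal.ofReal (lam ^ (p * s - 1)) * X := by
    have hm : Measurable fun x : RSpace d => ENNReal.ofReal (|g x| * x L ^ (-s)) ^ p :=
      ((hg.abs.mul hw).ennreal_ofReal).pow_const _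
    -- The factor `lam ^ (p * s)` compensates for the weight, which is taken at `x` and not at the
    -- sheared point, whose last coordinate is `lam * x_d`.
    have h1 := setLIntegral_shear hd v hv (hm.const_mul (ENNReal.ofReal (lam ^ (p * s))))
    rw [lintegral_const_mul _ hm, ← mul_assoc, ← ENNReal.ofReal_mul (by positivity)] at h1
    rw [Real.rpow_sub_one hv.ne', div_eq_inv_mul, ← h1]
    refine setLIntegral_congr_fun hH fun x hx => ?_
    have hx' : 0 < x L := hx
    have h2 : (x + x L • v) L = lam * x L := by simp [lam]; ring
    simp only
    rw [h2, Real.mul_rpow hv.le hx'.le, mul_comm p s, Real.rpow_mul hv.le,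
      ← ENNReal.ofReal_rpow_of_nonneg (by positivity) hp0.le,
      ← ENNReal.mul_rpow_of_nonneg _ _ hp0.le, ← ENNReal.ofReal_mul (by positivity)]
    congr 2
    rw [Real.rpow_neg hv.le]
    field_simp
    rfl
  have hmink : X ^ (1 / p) ≤ D ^ (1 / p) + ENNReal.ofReal θ * X ^ (1 / p) := by
    have hmD : Measurable fun x : RSpace d =>
        ENNReal.ofReal (|g (x + x L • v) - g x| * x L ^ (-s)) :=
      ((((hg.comp hT).sub hg).abs).mul hw).ennreal_ofReal
    have hmS : Measurable fun x : RSpace d =>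
        ENNReal.ofReal (|g (x + x L • v)| * x L ^ (-s)) :=
      ((hg.comp hT).abs.mul hw).ennreal_ofReal
    have h3 := ENNReal.lintegral_Lp_add_le (μ := volume.restrict (halfSpace d hd : Set (RSpace d)))
      hmD.aemeasurable hmS.aemeasurable hp
    rw [hshift, ENNReal.mul_rpow_of_nonneg _ _ (by positivity),
      ENNReal.ofReal_rpow_of_nonneg (by positivity) (by positivity), ← Real.rpow_mul hv.le,
      mul_one_div] at h3
    refine le_trans ?_ (h3.trans ?_)
    · gcongr
      refine setLIntegral_mono' hH fun x hx => ?_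
      have hx' : 0 < x L := hx
      simp only [Pi.add_apply]
      rw [← ENNReal.ofReal_add (by positivity) (by positivity), ← add_mul]
      gcongr
      have := abs_sub_abs_le_abs_sub (g x) (g (x + x L • v))
      rw [abs_sub_comm] at this
      linarith
    · gcongr
  have hXf : X ^ (1 / p) ≠ ∞ := ENNReal.rpow_ne_top_of_nonneg (by positivity) hfin
  -- Absorbing the `θ` term into the left side is where finiteness of `X` is indispensable.
  have h4 : ENNReal.ofReal (1 - θ) * X ^ (1 / p) ≤ D ^ (1 / p) := by
    have h5 : ENNReal.ofReal (1 - θ) * X ^ (1 / p) + ENNReal.ofReal θ * X ^ (1 / p) =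
        X ^ (1 / p) := by
      rw [← add_mul, ← ENNReal.ofReal_add (by linarith) hθ0]; simp
    rw [← h5] at hmink
    exact (ENNReal.add_le_add_iff_right (ENNReal.mul_ne_top ENNReal.ofReal_ne_top hXf)).1
      (by rwa [h5] at hmink ⊢)
  have h6 : X ^ (1 / p) ≤ ENNReal.ofReal (1 - θ)⁻¹ * D ^ (1 / p) := by
    calc X ^ (1 / p) = ENNReal.ofReal (1 - θ)⁻¹ * (ENNReal.ofReal (1 - θ) * X ^ (1 / p)) := by
          rw [← mul_assoc, ← ENNReal.ofReal_mul (inv_nonneg.2 (by linarith)),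
            inv_mul_cancel₀ (by linarith)]
          simp
      _ ≤ _ := by gcongr
  have h7 := ENNReal.rpow_le_rpow h6 hp0.le
  rwa [ENNReal.mul_rpow_of_nonneg _ _ hp0.le, ← ENNReal.rpow_mul, ← ENNReal.rpow_mul,
    one_div_mul_cancel hp0.ne', ENNReal.rpow_one, ENNReal.rpow_one] at h7

/-- With the weight inside the `p`-th power, the integral is that of an `L^p` norm, ready for
Minkowski. -/
lemma hardyIntegral_eq {d : ℕ} (hd : 1 ≤ d) {p s : ℝ} (hp : 0 < p) (u : RSpace d → RSpace d) :
    hardyIntegral d hd p s u = ∫⁻ x in (halfSpace d hd : Set (RSpace d)),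
      ENNReal.ofReal (‖u x‖ * x (lastIdx d hd) ^ (-s)) ^ p := by
  refine setLIntegral_congr_fun (halfSpace d hd).isOpen.measurableSet fun x hx => ?_
  have hx' : 0 < x (lastIdx d hd) := hx
  simp only
  rw [ENNReal.ofReal_rpow_of_nonneg (by positivity) hp.le,
    Real.mul_rpow (norm_nonneg _) (by positivity), ← Real.rpow_mul hx'.le,
    div_eq_mul_inv, ← Real.rpow_neg hx'.le]
  congr 3
  ring

/-- Increments of `u` in the direction `v`, measured at the scale `x_d`, are controlled by the
integrand of the seminorm. -/
lemma ofReal_inner_sub_rpow_le {d : ℕ} {p s : ℝ} (hp : 0 < p) (hs : 0 < s)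
    (u : RSpace d → RSpace d) (x v : RSpace d) {t : ℝ} (ht : 0 < t) (hv : ‖v‖ ≤ 2) :
    ENNReal.ofReal (|inner ℝ (u (x + t • v)) v - inner ℝ (u x) v| * t ^ (-s)) ^ p ≤
      ENNReal.ofReal (2 ^ (p + (d + p * s))) * (ENNReal.ofReal (t ^ d) *
        ENNReal.ofReal (|projDiff u x (x + t • v)| ^ p /
          ‖x + t • v - x‖ ^ ((d : ℝ) + p * s))) := by
  rcases eq_or_ne v 0 with rfl | hv0
  · simp [ENNReal.zero_rpow_of_pos hp]
  have hn : 0 < ‖v‖ := norm_pos_iff.2 hv0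
  have hdiff : projDiff u x (x + t • v) =
      ‖v‖⁻¹ * (inner ℝ (u (x + t • v)) v - inner ℝ (u x) v) := by
    rw [projDiff, add_sub_cancel_left, norm_smul, Real.norm_of_nonneg ht.le, smul_smul,
      inner_smul_right, inner_sub_left]
    congr 1
    field_simp
  rw [hdiff, add_sub_cancel_left, norm_smul, Real.norm_of_nonneg ht.le, abs_mul, abs_inv, abs_norm]
  set a := |inner ℝ (u (x + t • v)) v - inner ℝ (u x) v| with ha
  have ha0 : 0 ≤ a := abs_nonneg _
  have hps : 0 < p * s := mul_pos hp hs
  rw [ENNReal.ofReal_rpow_of_nonneg (by positivity) hp.le, ← ENNReal.ofReal_mul (by positivity),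
    ← ENNReal.ofReal_mul (by positivity)]
  apply ENNReal.ofReal_le_ofReal
  have e1 : (a * t ^ (-s)) ^ p = a ^ p * t ^ (-(p * s)) := by
    rw [Real.mul_rpow ha0 (by positivity), ← Real.rpow_mul ht.le]
    congr 2; ring
  -- The Jacobian `t ^ d` cancels the dimensional part of the kernel, leaving exactly the Hardy
  -- weight and a power of `‖v‖`.
  have e2 : t ^ d * ((‖v‖⁻¹ * a) ^ p / (t * ‖v‖) ^ ((d : ℝ) + p * s)) =
      (a ^ p * t ^ (-(p * s))) * (‖v‖ ^ (p + (d + p * s)))⁻¹ := by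
    rw [Real.mul_rpow (by positivity) ha0, Real.mul_rpow ht.le hn.le, Real.inv_rpow hn.le,
      Real.rpow_add ht, Real.rpow_natCast, Real.rpow_neg ht.le, Real.rpow_add hn p]
    field_simp
  rw [e1, e2]
  have h3 : 1 ≤ 2 ^ (p + (d + p * s)) * (‖v‖ ^ (p + (d + p * s)))⁻¹ := by
    rw [← div_eq_mul_inv, one_le_div (by positivity)]
    exact Real.rpow_le_rpow hn.le hv (by positivity)
  calc a ^ p * t ^ (-(p * s)) = a ^ p * t ^ (-(p * s)) * 1 := by ring
    _ ≤ a ^ p * t ^ (-(p * s)) * (2 ^ (p + (d + p * s)) * (‖v‖ ^ (p + (d + p * s)))⁻¹) := by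
        gcongr
    _ = _ := by ring

/-! ### Measurability of the integrands. -/

lemma measurable_projDiff {d : ℕ} {u : RSpace d → RSpace d} (hu : Measurable u) :
    Measurable fun z : RSpace d × RSpace d => projDiff u z.1 z.2 := by
  unfold projDiff
  exact ((hu.comp measurable_snd).sub (hu.comp measurable_fst)).inner
    ((measurable_snd.sub measurable_fst).norm.inv.smul (measurable_snd.sub measurable_fst))

lemma measurable_seminorm_integrand {d : ℕ} (p s : ℝ) {u : RSpace d → RSpace d}
    (hu : Measurable u) :
    Measurable fun z : RSpace d × RSpace d =>
      ENNReal.ofReal (|projDiff u z.1 z.2| ^ p / ‖z.2 - z.1‖ ^ ((d : ℝ) + p * s)) :=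
  (((measurable_projDiff hu).abs.pow_const _).div
    ((measurable_snd.sub measurable_fst).norm.pow_const _)).ennreal_ofReal

lemma measurable_seminorm_integrand_right {d : ℕ} (p s : ℝ) {u : RSpace d → RSpace d}
    (hu : Measurable u) (x : RSpace d) :
    Measurable fun y : RSpace d =>
      ENNReal.ofReal (|projDiff u x y| ^ p / ‖y - x‖ ^ ((d : ℝ) + p * s)) := by
  have hn : Measurable fun y : RSpace d => ‖y - x‖ := by fun_prop
  have hx : Measurable fun y : RSpace d => projDiff u x y :=
    (hu.sub_const (u x)).inner (hn.inv.smul (measurable_id.sub_const x))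
  exact ((hx.abs.pow_const _).div (hn.pow_const _)).ennreal_ofReal

lemma abs_apply_le_norm {d : ℕ} (v : RSpace d) (i : Fin d) : |v i| ≤ ‖v‖ := by
  simpa using PiLp.norm_apply_le v i

/-! ### The inequality under a finiteness assumption. -/

/-- The directions used in the averaging: a ball on which the shear `x ↦ x + x_d v` contracts the
weighted norm by a uniform factor. -/
lemma exists_contracting_ball {d : ℕ} (hd : 1 ≤ d) {p s : ℝ} (hp : 0 < p) (hps : p * s ≠ 1) :
    ∃ (v₀ : RSpace d) (θ : ℝ), θ < 1 ∧ ∀ v ∈ Metric.ball v₀ (1 / 4),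
      ‖v‖ ≤ 2 ∧ 0 < 1 + v (lastIdx d hd) ∧
        (1 + v (lastIdx d hd)) ^ ((p * s - 1) / p) ≤ θ := by
  set L := lastIdx d hd
  have hball : ∀ (τ : ℝ) (v : RSpace d), v ∈ Metric.ball (EuclideanSpace.single L τ) (1 / 4) →
      ‖v‖ ≤ |τ| + 1 / 4 ∧ |v L - τ| < 1 / 4 := by
    intro τ v hv
    rw [Metric.mem_ball, dist_eq_norm] at hv
    constructor
    · have := norm_le_norm_add_norm_sub' v (EuclideanSpace.single L τ)
      rw [PiLp.norm_single, Real.norm_eq_abs] at this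
      linarith
    · have := abs_apply_le_norm (v - EuclideanSpace.single L τ) L
      simp only [PiLp.sub_apply, PiLp.single_apply, if_true] at this
      linarith
  rcases lt_or_gt_of_ne hps with h | h
  · have he : (p * s - 1) / p < 0 := div_neg_of_neg_of_pos (by linarith) hp
    -- On this ball `1 + v_d > 9 / 4 ≥ 2`, and the exponent is negative.
    refine ⟨EuclideanSpace.single L (3 / 2), 2 ^ ((p * s - 1) / p),
      Real.rpow_lt_one_of_one_lt_of_neg (by norm_num) he, fun v hv => ?_⟩
    obtain ⟨h1, h2⟩ := hball _ v hv
    rw [abs_of_pos (by norm_num)] at h1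
    have h3 := (abs_lt.1 h2).1
    exact ⟨by linarith, by linarith,
      Real.rpow_le_rpow_of_nonpos (by norm_num) (by linarith) he.le⟩
  · have he : 0 < (p * s - 1) / p := div_pos (by linarith) hp
    -- On this ball `0 < 1 + v_d < 1 / 2`, and the exponent is positive.
    refine ⟨EuclideanSpace.single L (-(3 / 4)), (1 / 2) ^ ((p * s - 1) / p),
      Real.rpow_lt_one (by norm_num) (by norm_num) he, fun v hv => ?_⟩
    obtain ⟨h1, h2⟩ := hball _ v hv
    rw [abs_neg, abs_of_pos (by norm_num)] at h1
    obtain ⟨h3, h4⟩ := abs_lt.1 h2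
    exact ⟨by linarith, by linarith,
      Real.rpow_le_rpow (by linarith) (by linarith) he.le⟩

/-- Averaging the increments over the shear directions gives at most the inner integral of the
seminorm. -/
lemma setLIntegral_increment_le {d : ℕ} (hd : 1 ≤ d) {p s : ℝ} (hp : 0 < p) (hs : 0 < s)
    {V : Set (RSpace d)} (hVm : MeasurableSet V)
    (hV : ∀ v ∈ V, ‖v‖ ≤ 2 ∧ 0 < 1 + v (lastIdx d hd))
    {u : RSpace d → RSpace d} (hu : Measurable u) {x : RSpace d}
    (hx : 0 < x (lastIdx d hd)) :
    ∫⁻ v in V, ENNReal.ofReal (|inner ℝ (u (x + x (lastIdx d hd) • v)) v - inner ℝ (u x) v| *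
        x (lastIdx d hd) ^ (-s)) ^ p ≤
      ENNReal.ofReal (2 ^ (p + (d + p * s))) * ∫⁻ y in (halfSpace d hd : Set (RSpace d)),
        ENNReal.ofReal (|projDiff u x y| ^ p / ‖y - x‖ ^ ((d : ℝ) + p * s)) := by
  set L := lastIdx d hd
  have hH : MeasurableSet (halfSpace d hd : Set (RSpace d)) := (halfSpace d hd).isOpen.measurableSet
  obtain ⟨Q, hQ⟩ : ∃ Q : RSpace d → ℝ≥0∞, Q = fun y =>
      ENNReal.ofReal (|projDiff u x y| ^ p / ‖y - x‖ ^ ((d : ℝ) + p * s)) := ⟨_, rfl⟩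
  have hQm : Measurable Q := by
    rw [hQ]
    exact measurable_seminorm_integrand_right p s hu x
  have hQi : Measurable ((halfSpace d hd : Set (RSpace d)).indicator Q) := hQm.indicator hH
  have haff : Measurable fun v : RSpace d => x + x L • v := by fun_prop
  have hQc : Measurable fun v : RSpace d =>
      (halfSpace d hd : Set (RSpace d)).indicator Q (x + x L • v) := hQi.comp haff
  rw [← hQ, ← lintegral_indicator hH, ← lintegral_comp_add_smul x hx hQi,
    ← lintegral_const_mul _ hQc, ← lintegral_const_mul _ (hQc.const_mul _)]
  refine (setLIntegral_mono' hVm fun v hv => ?_).trans (setLIntegral_le_lintegral V _)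
  obtain ⟨hv2, hv1⟩ := hV v hv
  have hmem : x + x L • v ∈ (halfSpace d hd : Set (RSpace d)) := by
    change 0 < (x + x L • v) L
    have : (x + x L • v) L = x L * (1 + v L) := by simp; ring
    rw [this]
    exact mul_pos hx hv1
  rw [Set.indicator_of_mem hmem, hQ]
  exact ofReal_inner_sub_rpow_le hp hs u x v hx hv2

/-- The Hardy inequality for measurable fields whose Hardy integral is known to be finite. -/
lemma exists_hardyIntegral_le_of_ne_top {d : ℕ} (hd : 1 ≤ d) {p s : ℝ} (hp : 1 ≤ p) (hs : 0 < s)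
    (hps : p * s ≠ 1) :
    ∃ C : ℝ≥0∞, C ≠ ∞ ∧ ∀ u : RSpace d → RSpace d, Measurable u →
      hardyIntegral d hd p s u ≠ ∞ →
      hardyIntegral d hd p s u ≤ C * seminormPow p s (halfSpace d hd) u := by
  have hp0 : 0 < p := by linarith
  obtain ⟨v₀, θ, hθ1, hball⟩ := exists_contracting_ball hd hp0 hps
  set L := lastIdx d hd
  set V := Metric.ball v₀ (1 / 4 : ℝ)
  set K := ENNReal.ofReal (1 - θ)⁻¹ ^ p
  set M := ENNReal.ofReal (2 ^ (p + (d + p * s)))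
  set c := ENNReal.ofReal (1 / 4 / 4) ^ p * volume (Metric.ball (0 : RSpace d) (1 / 4 / 4)) with hc
  have hc0 : c ≠ 0 := by
    refine mul_ne_zero ?_ (Metric.measure_ball_pos volume _ (by norm_num)).ne'
    exact (ENNReal.rpow_pos (by norm_num) ENNReal.ofReal_ne_top).ne'
  have hcT : c ≠ ∞ := ENNReal.mul_ne_top
    (ENNReal.rpow_ne_top_of_nonneg hp0.le ENNReal.ofReal_ne_top) measure_ball_lt_top.ne
  refine ⟨c⁻¹ * (K * M), ENNReal.mul_ne_top (ENNReal.inv_ne_top.2 hc0) (ENNReal.mul_ne_top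
    (ENNReal.rpow_ne_top_of_nonneg hp0.le ENNReal.ofReal_ne_top) ENNReal.ofReal_ne_top), ?_⟩
  intro u hu hfin
  rw [hardyIntegral_eq hd hp0] at hfin ⊢
  have hH : MeasurableSet (halfSpace d hd : Set (RSpace d)) := (halfSpace d hd).isOpen.measurableSet
  have hL : Measurable fun x : RSpace d => x L := by fun_prop
  have hw : Measurable fun x : RSpace d => x L ^ (-s) := hL.pow_const _
  have hm0 : Measurable fun x : RSpace d => ENNReal.ofReal (‖u x‖ * x L ^ (-s)) ^ p :=
    ((hu.norm.mul hw).ennreal_ofReal).pow_const _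
  have hm1 : Measurable fun z : RSpace d × RSpace d =>
      ENNReal.ofReal (|inner ℝ (u z.1) z.2| * z.1 L ^ (-s)) ^ p :=
    (((((hu.comp measurable_fst).inner measurable_snd).abs).mul
      (hw.comp measurable_fst)).ennreal_ofReal).pow_const _
  have hsh : Measurable fun z : RSpace d × RSpace d => z.1 + z.1 L • z.2 := by fun_prop
  have hm2 : Measurable fun z : RSpace d × RSpace d => ENNReal.ofReal
      (|inner ℝ (u (z.1 + z.1 L • z.2)) z.2 - inner ℝ (u z.1) z.2| * z.1 L ^ (-s)) ^ p :=
    ((((((hu.comp hsh).inner measurable_snd).sub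
      ((hu.comp measurable_fst).inner measurable_snd)).abs).mul
      (hw.comp measurable_fst)).ennreal_ofReal).pow_const _
  have step1 : c * ∫⁻ x in (halfSpace d hd : Set (RSpace d)),
      ENNReal.ofReal (‖u x‖ * x L ^ (-s)) ^ p ≤
      ∫⁻ x in (halfSpace d hd : Set (RSpace d)), ∫⁻ v in V,
        ENNReal.ofReal (|inner ℝ (u x) v| * x L ^ (-s)) ^ p := by
    rw [← lintegral_const_mul _ hm0]
    refine setLIntegral_mono' hH fun x hx => ?_
    have hx' : 0 < x L := hx
    have h := le_setLIntegral_ball_inner hp0 (u x) v₀ (r := 1 / 4) (by norm_num)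
    have hi : Measurable fun v : RSpace d => ENNReal.ofReal |inner ℝ (u x) v| ^ p :=
      ((measurable_const.inner measurable_id).abs.ennreal_ofReal).pow_const _
    calc c * ENNReal.ofReal (‖u x‖ * x L ^ (-s)) ^ p
        = c * ENNReal.ofReal ‖u x‖ ^ p * ENNReal.ofReal (x L ^ (-s)) ^ p := by
          rw [ENNReal.ofReal_mul (norm_nonneg _), ENNReal.mul_rpow_of_nonneg _ _ hp0.le, ← mul_assoc]
      _ ≤ (∫⁻ v in V, ENNReal.ofReal |inner ℝ (u x) v| ^ p) *
            ENNReal.ofReal (x L ^ (-s)) ^ p := by gcongr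
      _ = _ := by
          rw [← lintegral_mul_const _ hi]
          refine lintegral_congr fun v => ?_
          rw [ENNReal.ofReal_mul (abs_nonneg _), ENNReal.mul_rpow_of_nonneg _ _ hp0.le]
  have step2 : ∀ v ∈ V, ∫⁻ x in (halfSpace d hd : Set (RSpace d)),
      ENNReal.ofReal (|inner ℝ (u x) v| * x L ^ (-s)) ^ p ≤
      K * ∫⁻ x in (halfSpace d hd : Set (RSpace d)), ENNReal.ofReal
        (|inner ℝ (u (x + x L • v)) v - inner ℝ (u x) v| * x L ^ (-s)) ^ p := by
    intro v hv
    obtain ⟨hv2, hv1, hvθ⟩ := hball v hv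
    refine setLIntegral_le_of_shear hd hp v hv1 hvθ hθ1 (hu.inner measurable_const) ?_
    have h1 : ∫⁻ x in (halfSpace d hd : Set (RSpace d)),
        ENNReal.ofReal (|inner ℝ (u x) v| * x L ^ (-s)) ^ p ≤
        ENNReal.ofReal ‖v‖ ^ p * ∫⁻ x in (halfSpace d hd : Set (RSpace d)),
          ENNReal.ofReal (‖u x‖ * x L ^ (-s)) ^ p := by
      rw [← lintegral_const_mul _ hm0]
      refine setLIntegral_mono' hH fun x hx => ?_
      have hx' : 0 < x L := hx
      rw [← ENNReal.mul_rpow_of_nonneg _ _ hp0.le, ← ENNReal.ofReal_mul (norm_nonneg _),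
        ← mul_assoc]
      gcongr
      rw [mul_comm]
      exact abs_real_inner_le_norm _ _
    exact ne_top_of_le_ne_top (ENNReal.mul_ne_top
      (ENNReal.rpow_ne_top_of_nonneg hp0.le ENNReal.ofReal_ne_top) hfin) h1
  have step3 : ∀ x ∈ (halfSpace d hd : Set (RSpace d)),
      ∫⁻ v in V, ENNReal.ofReal
        (|inner ℝ (u (x + x L • v)) v - inner ℝ (u x) v| * x L ^ (-s)) ^ p ≤
      M * ∫⁻ y in (halfSpace d hd : Set (RSpace d)),
        ENNReal.ofReal (|projDiff u x y| ^ p / ‖y - x‖ ^ ((d : ℝ) + p * s)) := 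
    fun x hx => setLIntegral_increment_le hd hp0 hs measurableSet_ball
      (fun v hv => ⟨(hball v hv).1, (hball v hv).2.1⟩) hu hx
  have main : c * ∫⁻ x in (halfSpace d hd : Set (RSpace d)),
      ENNReal.ofReal (‖u x‖ * x L ^ (-s)) ^ p ≤
      K * M * seminormPow p s (halfSpace d hd) u := by
    calc _ ≤ _ := step1
      _ = ∫⁻ v in V, ∫⁻ x in (halfSpace d hd : Set (RSpace d)),
          ENNReal.ofReal (|inner ℝ (u x) v| * x L ^ (-s)) ^ p :=
          lintegral_lintegral_swap hm1.aemeasurable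
      _ ≤ ∫⁻ v in V, K * ∫⁻ x in (halfSpace d hd : Set (RSpace d)), ENNReal.ofReal
          (|inner ℝ (u (x + x L • v)) v - inner ℝ (u x) v| * x L ^ (-s)) ^ p :=
          setLIntegral_mono' measurableSet_ball step2
      _ = K * ∫⁻ v in V, ∫⁻ x in (halfSpace d hd : Set (RSpace d)), ENNReal.ofReal
          (|inner ℝ (u (x + x L • v)) v - inner ℝ (u x) v| * x L ^ (-s)) ^ p :=
          lintegral_const_mul _ hm2.lintegral_prod_left'
      _ = K * ∫⁻ x in (halfSpace d hd : Set (RSpace d)), ∫⁻ v in V, ENNReal.ofReal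
          (|inner ℝ (u (x + x L • v)) v - inner ℝ (u x) v| * x L ^ (-s)) ^ p := by
          congr 1
          exact (lintegral_lintegral_swap hm2.aemeasurable).symm
      _ ≤ K * ∫⁻ x in (halfSpace d hd : Set (RSpace d)), M *
          ∫⁻ y in (halfSpace d hd : Set (RSpace d)),
            ENNReal.ofReal (|projDiff u x y| ^ p / ‖y - x‖ ^ ((d : ℝ) + p * s)) := by
          gcongr 1
          exact setLIntegral_mono' hH step3
      _ = _ := by
          rw [lintegral_const_mul _ (measurable_seminorm_integrand p s hu).lintegral_prod_right',
            ← mul_assoc]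
          rfl
  calc _ = c⁻¹ * (c * ∫⁻ x in (halfSpace d hd : Set (RSpace d)),
        ENNReal.ofReal (‖u x‖ * x L ^ (-s)) ^ p) := by
        rw [← mul_assoc, ENNReal.inv_mul_cancel hc0 hcT, one_mul]
    _ ≤ c⁻¹ * (K * M * seminormPow p s (halfSpace d hd) u) := by gcongr
    _ = _ := by ring

/-! ### Test functions and passage to the closure. -/

/-- A compact support inside the open half space stays away from `x_d = 0`, so the integrand is
bounded there. This supplies the finiteness that the absorption step requires. -/
lemma hardyIntegral_testFunction_ne_top {d : ℕ} (hd : 1 ≤ d) {p : ℝ} (s : ℝ) (hp : 0 < p)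
    (φ : 𝓓^{1}(halfSpace d hd, RSpace d)) : hardyIntegral d hd p s φ ≠ ∞ := by
  have hK : IsCompact (tsupport φ) := φ.hasCompactSupport
  have hsub : tsupport φ ⊆ (halfSpace d hd : Set (RSpace d)) := φ.tsupport_subset
  have hcont : ContinuousOn
      (fun x => ‖φ x‖ ^ p / (x (lastIdx d hd)) ^ (p * s)) (tsupport φ) := by
    refine ContinuousOn.div ?_ ?_ ?_
    · exact (φ.continuous.norm.rpow_const fun _ => Or.inr hp.le).continuousOn
    · refine ContinuousOn.rpow_const (by fun_prop) fun x hx => Or.inl ?_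
      exact ne_of_gt (hsub hx)
    · intro x hx
      exact (Real.rpow_pos_of_pos (hsub hx) _).ne'
  obtain ⟨C, hC⟩ := hK.exists_bound_of_continuousOn hcont
  have h1 : hardyIntegral d hd p s φ ≤ ∫⁻ x, (tsupport φ).indicator (fun _ => ENNReal.ofReal C) x := by
    refine (setLIntegral_le_lintegral _ _).trans (lintegral_mono fun x => ?_)
    by_cases hx : x ∈ tsupport φ
    · rw [Set.indicator_of_mem hx]
      exact ENNReal.ofReal_le_ofReal ((le_abs_self _).trans (hC x hx))
    · simp [image_eq_zero_of_notMem_tsupport hx, Real.zero_rpow hp.ne']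
  refine ne_top_of_le_ne_top ?_ h1
  rw [lintegral_indicator_const hK.isClosed.measurableSet]
  exact ENNReal.mul_ne_top ENNReal.ofReal_ne_top hK.measure_lt_top.ne

lemma seminormPow_congr_ae {d : ℕ} (p s : ℝ) {Ω : Opens (RSpace d)} {u w : RSpace d → RSpace d}
    (h : u =ᵐ[volume.restrict (Ω : Set (RSpace d))] w) :
    seminormPow p s Ω u = seminormPow p s Ω w := by
  refine lintegral_congr_ae ?_
  filter_upwards [h] with x hx
  refine lintegral_congr_ae ?_
  filter_upwards [h] with y hy
  simp only [projDiff, hx, hy]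

lemma hardyIntegral_congr_ae {d : ℕ} (hd : 1 ≤ d) (p s : ℝ) {u w : RSpace d → RSpace d}
    (h : u =ᵐ[volume.restrict (halfSpace d hd : Set (RSpace d))] w) :
    hardyIntegral d hd p s u = hardyIntegral d hd p s w := by
  refine lintegral_congr_ae ?_
  filter_upwards [h] with x hx
  rw [hx]

/-- Convexity of `t ↦ t ^ p` in place of Minkowski for the double integral; the price is the factor
`2 ^ (p - 1)` in the final constant. -/
lemma seminormPow_le_add {d : ℕ} {p : ℝ} (s : ℝ) (hp : 1 ≤ p) (Ω : Opens (RSpace d))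
    {u : RSpace d → RSpace d} (hu : Measurable u) (w : RSpace d → RSpace d) :
    seminormPow p s Ω w ≤
      2 ^ (p - 1) * (seminormPow p s Ω u + seminormPow p s Ω (fun x => u x - w x)) := by
  have hp0 : 0 < p := by linarith
  have hmu := measurable_seminorm_integrand p s hu
  have hpt : ∀ x y : RSpace d,
      ENNReal.ofReal (|projDiff w x y| ^ p / ‖y - x‖ ^ ((d : ℝ) + p * s)) ≤
        2 ^ (p - 1) * (ENNReal.ofReal (|projDiff u x y| ^ p / ‖y - x‖ ^ ((d : ℝ) + p * s)) +
          ENNReal.ofReal (|projDiff (fun x => u x - w x) x y| ^ p /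
            ‖y - x‖ ^ ((d : ℝ) + p * s))) := by
    intro x y
    have hd1 : projDiff w x y = projDiff u x y - projDiff (fun x => u x - w x) x y := by
      simp only [projDiff]
      rw [← inner_sub_left]
      congr 1
      abel
    have hr : ∀ t : ℝ, ENNReal.ofReal (|t| ^ p / ‖y - x‖ ^ ((d : ℝ) + p * s)) =
        ENNReal.ofReal |t| ^ p * ENNReal.ofReal (‖y - x‖ ^ ((d : ℝ) + p * s))⁻¹ := by
      intro t
      rw [div_eq_mul_inv, ENNReal.ofReal_mul (by positivity),
        ENNReal.ofReal_rpow_of_nonneg (abs_nonneg _) hp0.le]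
    rw [hr, hr, hr, ← add_mul, ← mul_assoc]
    gcongr
    refine le_trans ?_ (ENNReal.rpow_add_le_mul_rpow_add_rpow _ _ hp)
    gcongr
    rw [← ENNReal.ofReal_add (abs_nonneg _) (abs_nonneg _), hd1]
    exact ENNReal.ofReal_le_ofReal (abs_sub _ _)
  have hx : ∀ x, Measurable fun y =>
      ENNReal.ofReal (|projDiff u x y| ^ p / ‖y - x‖ ^ ((d : ℝ) + p * s)) :=
    measurable_seminorm_integrand_right p s hu
  have h2 : (2 : ℝ≥0∞) ^ (p - 1) ≠ ∞ := ENNReal.rpow_ne_top_of_nonneg (by linarith) (by simp)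
  unfold seminormPow
  rw [← lintegral_add_left hmu.lintegral_prod_right',
    ← lintegral_const_mul' _ _ h2]
  refine lintegral_mono fun x => ?_
  rw [← lintegral_add_left (hx x), ← lintegral_const_mul' _ _ h2]
  exact lintegral_mono fun y => hpt x y

lemma eLpNorm_le_sNorm {d : ℕ} {p : ℝ} (s : ℝ) (hp : 0 < p) (Ω : Opens (RSpace d))
    (u : RSpace d → RSpace d) :
    eLpNorm u (ENNReal.ofReal p) (volume.restrict (Ω : Set (RSpace d))) ≤ sNorm p s Ω u := by
  rw [sNorm, one_div, ENNReal.le_rpow_inv_iff hp]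
  exact le_self_add

lemma seminormPow_le_sNorm_rpow {d : ℕ} {p : ℝ} (s : ℝ) (hp : 0 < p) (Ω : Opens (RSpace d))
    (u : RSpace d → RSpace d) : seminormPow p s Ω u ≤ sNorm p s Ω u ^ p := by
  rw [sNorm, ← ENNReal.rpow_mul, one_div_mul_cancel hp.ne', ENNReal.rpow_one]
  exact le_add_self

lemma sNorm_congr_ae {d : ℕ} (p s : ℝ) {Ω : Opens (RSpace d)} {u w : RSpace d → RSpace d}
    (h : u =ᵐ[volume.restrict (Ω : Set (RSpace d))] w) : sNorm p s Ω u = sNorm p s Ω w := by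
  rw [sNorm, sNorm, eLpNorm_congr_ae h, seminormPow_congr_ae p s h]

open Filter Topology in
/-- The Hardy inequality passes from test functions to limits of test functions. -/
lemma hardyIntegral_le_of_approx {d : ℕ} (hd : 1 ≤ d) {p s : ℝ} (hp : 1 ≤ p) {C : ℝ≥0∞}
    (hC : C ≠ ∞)
    (hφ : ∀ φ : 𝓓^{1}(halfSpace d hd, RSpace d),
      hardyIntegral d hd p s φ ≤ C * seminormPow p s (halfSpace d hd) φ)
    {u : RSpace d → RSpace d} (hu : Measurable u)
    (happ : ∀ ε : ℝ≥0∞, 0 < ε → ∃ φ : 𝓓^{1}(halfSpace d hd, RSpace d),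
      sNorm p s (halfSpace d hd) (fun x => u x - φ x) < ε) :
    hardyIntegral d hd p s u ≤ C * 2 ^ (p - 1) * seminormPow p s (halfSpace d hd) u := by
  have hp0 : 0 < p := by linarith
  set Ω := halfSpace d hd
  have hΩ : MeasurableSet (Ω : Set (RSpace d)) := Ω.isOpen.measurableSet
  -- For `n = 0` the tolerance is `∞`, which is harmless.
  choose ψ hψ using fun n : ℕ => happ (n : ℝ≥0∞)⁻¹ (ENNReal.inv_pos.2 (ENNReal.natCast_ne_top n))
  have hlim : Tendsto (fun n => sNorm p s Ω (fun x => u x - ψ n x)) atTop (𝓝 0) :=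
    tendsto_of_tendsto_of_tendsto_of_le_of_le tendsto_const_nhds
      ENNReal.tendsto_inv_nat_nhds_zero (fun _ => zero_le) fun n => (hψ n).le
  have hLp : Tendsto (fun n => eLpNorm ((ψ n : RSpace d → RSpace d) - u) (ENNReal.ofReal p)
      (volume.restrict (Ω : Set (RSpace d)))) atTop (𝓝 0) := by
    refine tendsto_of_tendsto_of_tendsto_of_le_of_le tendsto_const_nhds hlim
      (fun _ => zero_le) fun n => ?_
    rw [eLpNorm_sub_comm]
    exact eLpNorm_le_sNorm s hp0 Ω _
  obtain ⟨k, hk, hae⟩ := (tendstoInMeasure_of_tendsto_eLpNorm (by simpa using hp0)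
    (fun n => (ψ n).continuous.aestronglyMeasurable)
    hu.aestronglyMeasurable hLp).exists_seq_tendsto_ae
  have hsemi : Tendsto (fun n => seminormPow p s Ω (fun x => u x - ψ (k n) x)) atTop (𝓝 0) := by
    have h0 : Tendsto (fun n => sNorm p s Ω (fun x => u x - ψ (k n) x) ^ p) atTop (𝓝 0) := by
      have := (hlim.comp hk.tendsto_atTop).ennrpow_const p
      simpa [ENNReal.zero_rpow_of_pos hp0] using this
    exact tendsto_of_tendsto_of_tendsto_of_le_of_le tendsto_const_nhds h0
      (fun _ => zero_le) fun n => seminormPow_le_sNorm_rpow s hp0 Ω _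
  have hfatou : hardyIntegral d hd p s u ≤
      liminf (fun n => hardyIntegral d hd p s (ψ (k n))) atTop := by
    refine le_trans (lintegral_mono_ae ?_) (lintegral_liminf_le fun n => ?_)
    · filter_upwards [hae, ae_restrict_mem hΩ] with x hx hxΩ
      have h1 : Tendsto (fun n => ENNReal.ofReal
          (‖ψ (k n) x‖ ^ p / (x (lastIdx d hd)) ^ (p * s))) atTop
          (𝓝 (ENNReal.ofReal (‖u x‖ ^ p / (x (lastIdx d hd)) ^ (p * s)))) :=
        ENNReal.tendsto_ofReal
          ((hx.norm.rpow_const (Or.inr hp0.le)).div_const _)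
      exact h1.liminf_eq.ge
    · have hL : Measurable fun x : RSpace d => x (lastIdx d hd) := by fun_prop
      exact (((ψ (k n)).continuous.measurable.norm.pow_const _).div
        (hL.pow_const _)).ennreal_ofReal
  have hbound : Tendsto (fun n => C * (2 ^ (p - 1) *
      (seminormPow p s Ω u + seminormPow p s Ω (fun x => u x - ψ (k n) x)))) atTop
      (𝓝 (C * (2 ^ (p - 1) * (seminormPow p s Ω u + 0)))) :=
    ENNReal.Tendsto.const_mul (ENNReal.Tendsto.const_mul (tendsto_const_nhds.add hsemi)
      (Or.inr (ENNReal.rpow_ne_top_of_nonneg (by linarith) (by simp)))) (Or.inr hC)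
  calc hardyIntegral d hd p s u ≤ _ := hfatou
    _ ≤ liminf (fun n => C * (2 ^ (p - 1) *
      (seminormPow p s Ω u + seminormPow p s Ω (fun x => u x - ψ (k n) x)))) atTop := by
        refine liminf_le_liminf (Eventually.of_forall fun n => (hφ _).trans ?_)
        gcongr
        exact seminormPow_le_add s hp Ω hu _
    _ = _ := by rw [hbound.liminf_eq, add_zero, mul_assoc]

end FractionalHardy

theorem mainTheorem2 (d : ℕ) (hd : 1 ≤ d) (p s : ℝ) (hp : 1 ≤ p) (hs0 : 0 < s) (hs1 : s < 1)
    (hps : p * s ≠ 1) :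
    ∃ κ : ℝ, 0 < κ ∧
      (∀ u : 𝓓^{1}(FractionalHardy.halfSpace d hd, FractionalHardy.RSpace d),
        FractionalHardy.hardyIntegral d hd p s u ≤
          ENNReal.ofReal κ *
            FractionalHardy.seminormPow p s (FractionalHardy.halfSpace d hd) u) ∧
      (∀ u : FractionalHardy.RSpace d → FractionalHardy.RSpace d,
        FractionalHardy.MemS p s (FractionalHardy.halfSpace d hd) u →
        FractionalHardy.hardyIntegral d hd p s u ≤
          ENNReal.ofReal κ *
            FractionalHardy.seminormPow p s (FractionalHardy.halfSpace d hd) u) := by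
  have hp0 : 0 < p := by linarith
  obtain ⟨C, hC, hCu⟩ := FractionalHardy.exists_hardyIntegral_le_of_ne_top hd hp hs0 hps
  have hφ : ∀ φ : 𝓓^{1}(FractionalHardy.halfSpace d hd, FractionalHardy.RSpace d),
      FractionalHardy.hardyIntegral d hd p s φ ≤
        C * FractionalHardy.seminormPow p s (FractionalHardy.halfSpace d hd) φ := fun φ =>
    hCu φ φ.continuous.measurable (FractionalHardy.hardyIntegral_testFunction_ne_top hd s hp0 φ)
  have h2 : (2 : ℝ≥0∞) ^ (p - 1) ≠ ∞ := ENNReal.rpow_ne_top_of_nonneg (by linarith) (by simp)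
  have hone : (1 : ℝ≥0∞) ≤ 2 ^ (p - 1) := by
    simpa using ENNReal.rpow_le_rpow_of_exponent_le (x := 2) (by norm_num)
      (show 0 ≤ p - 1 by linarith)
  -- Adding one keeps `κ` positive even if `C` vanishes. Since `2 ^ (p - 1) ≥ 1`, the same `κ`
  -- serves test functions.
  have hle : C * 2 ^ (p - 1) ≤ ENNReal.ofReal ((C * 2 ^ (p - 1)).toReal + 1) := by
    rw [ENNReal.ofReal_add ENNReal.toReal_nonneg zero_le_one,
      ENNReal.ofReal_toReal (ENNReal.mul_ne_top hC h2)]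
    exact le_self_add
  refine ⟨(C * 2 ^ (p - 1)).toReal + 1, by positivity, fun φ => ?_, fun u hu => ?_⟩
  · refine (hφ φ).trans ?_
    gcongr
    refine le_trans ?_ hle
    exact le_mul_of_one_le_right' hone
  · obtain ⟨hmem, -, happ⟩ := hu
    -- A field in `L^p` is only almost everywhere equal to a measurable one; all the integrals
    -- ignore the difference.
    have hae := hmem.1.ae_eq_mk
    rw [FractionalHardy.hardyIntegral_congr_ae hd p s hae,
      FractionalHardy.seminormPow_congr_ae p s hae]
    refine (FractionalHardy.hardyIntegral_le_of_approx hd hp hC hφ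
      hmem.1.stronglyMeasurable_mk.measurable fun ε hε => ?_).trans (by gcongr)
    obtain ⟨φ, h⟩ := happ ε hε
    refine ⟨φ, ?_⟩
    rwa [FractionalHardy.sNorm_congr_ae p s (w := fun x => u x - φ x)]
    filter_upwards [hae] with x hx
    rw [hx]
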